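/- Call two finite groups $L_1$ and $L_2$ \emph{compatible} if there exist a finite group $G$ and normal subgroups $M_1, M_2 \trianglelefteq G$ with $M_1 \cong M_2$ such that $L_1 \cong G/M_1$ and $L_2 \cong G/M_2$. Let $L_1$ and $L_2$ be finite groups of the same order. If there exist normal subgroups $N_1 \trianglelefteq L_1$ and $N_2 \trianglelefteq L_2$ such that $N_1 \cong N_2$ and both $L_1/N_1$ and $L_2/N_2$ are nilpotent, then $L_1$ and $L_2$ are compatible. In particular, any two finite nilpotent groups of the same order are compatible. -/

import Mathlib

/-- Two groups `L₁` and `L₂` are compatible if there is a finite group `G` with isomorphic normal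
subgroups `M₁` and `M₂` such that `L₁ ≅ G / M₁` and `L₂ ≅ G / M₂`. The group `G` is taken in
`Type`, which is no restriction, since every finite group is isomorphic to one there. -/
def GroupsCompatible (L₁ : Type*) (L₂ : Type*) [Group L₁] [Group L₂] : Prop :=
  ∃ (G : Type) (_ : Group G) (_ : Finite G) (M₁ M₂ : Subgroup G) (_ : M₁.Normal) (_ : M₂.Normal),
    Nonempty (M₁ ≃* M₂) ∧ Nonempty (L₁ ≃* G ⧸ M₁) ∧ Nonempty (L₂ ≃* G ⧸ M₂)

/-! It suffices to find a finite group mapping onto both `L₁` and `L₂` with isomorphic kernels. Two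
constructions carry the proof.

`exists_cover_of_equiv`: suppose `P` maps to `R₁` and `R₂`, onto modulo `S₁` and `S₂`, with
isomorphic preimages of `S₁ ≅ S₂`. Coinduce `S₁ × S₂` from `P` to the symmetric group of `P` and let
`P` act. The semidirect product maps onto each `Rᵢ` by `(u, p) ↦ ev(u)ᵢ * fᵢ p`, and the preimage of
any `T ≤ Sᵢ` splits as `T` times the kernel. The preimages of `S₁` and `S₂` in `P` are conjugate in
the symmetric group, which acts on the coinduced group, so the preimages of `S₁` and `S₂` in the
semidirect product are isomorphic. Hence preimages of isomorphic `Tᵢ ≤ Sᵢ` become isomorphic after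
one more direct factor. With `Sᵢ = Nᵢ` and `Tᵢ = ⊥` these are the kernels.

`exists_common_of_isNilpotent_quotient` supplies such a `P` by induction on the index of `Tᵢ`.
Nilpotency gives `Sᵢ` above `Tᵢ` with `Sᵢ / Tᵢ` central of prime order `p`. Passing to finite
quotients of a free group makes both the `Sᵢ` and the `Tᵢ` isomorphic (`exists_free_cover`):
subgroups of equal index in a free group have equal rank, and automorphisms permute transitively the
normal subgroups of index `p`. Induction for the `Sᵢ`, followed by the first construction, gives the
claim for the `Tᵢ`. -/

/-- If `σ` is a section of `g` over the subgroup `S` whose values commute with `g.ker`, then the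
preimage of every `T ≤ S` is the direct product of `T` and `g.ker`. -/
theorem comap_equiv_prod_ker {G R : Type*} [Group G] [Group R] (g : G →* R) (S T : Subgroup R)
    (hT : T ≤ S) (σ : S →* G) (hσ : ∀ s, g (σ s) = s)
    (hc : ∀ s, ∀ k ∈ g.ker, Commute (σ s) k) : Nonempty (T.comap g ≃* T × g.ker) := by
  let F : T × g.ker →* T.comap g :=
    { toFun := fun x => ⟨σ (Subgroup.inclusion hT x.1) * x.2, by
        simp [hσ, (MonoidHom.mem_ker).1 x.2.2]⟩
      map_one' := by ext; simp
      map_mul' := fun x y => by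
        ext
        have := hc (Subgroup.inclusion hT y.1) x.2 x.2.2
        simp only [Prod.fst_mul, Prod.snd_mul, map_mul, Subgroup.coe_mul]
        rw [mul_assoc, mul_assoc, ← mul_assoc _ (x.2 : G), this.eq]
        simp only [mul_assoc] }
  have hF : ∀ x, g (F x : G) = x.1 := fun x => by
    simp [F, hσ, (MonoidHom.mem_ker).1 x.2.2]
  refine ⟨(MulEquiv.ofBijective F ⟨?_, ?_⟩).symm⟩
  · intro x y hxy
    have h1 : x.1 = y.1 := by ext; rw [← hF, ← hF, hxy]
    refine Prod.ext h1 (Subtype.ext ?_)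
    have h2 := congrArg (Subtype.val) hxy
    simpa [F, h1] using h2
  · rintro ⟨y, hy⟩
    refine ⟨(⟨g y, hy⟩, ⟨(σ ⟨g y, hT hy⟩)⁻¹ * y, ?_⟩), ?_⟩
    · simp [MonoidHom.mem_ker, hσ]
    · ext
      simp [F, Subgroup.inclusion]

/-! ### Coinduced groups -/

/-- The group coinduced along `ι` from the group `A` with the action `α`. -/
def coind {P Γ A : Type*} [Group P] [Group Γ] [Group A] (ι : P →* Γ) (α : P →* MulAut A) :
    Subgroup (Γ → A) where
  carrier := {u | ∀ γ p, u (γ * ι p) = (α p)⁻¹ (u γ)}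
  one_mem' := fun γ p => by simp
  mul_mem' := fun {u v} hu hv γ p => by simp only [Pi.mul_apply, hu γ p, hv γ p, map_mul]
  inv_mem' := fun {u} hu γ p => by simp only [Pi.inv_apply, hu γ p, map_inv]

namespace coind

variable {P Γ A : Type*} [Group P] [Group Γ] [Group A] {ι : P →* Γ} {α : P →* MulAut A}

/-- The action of the larger group on a coinduced group by translation. -/
def act (ι : P →* Γ) (α : P →* MulAut A) : Γ →* MulAut (coind ι α) where
  toFun := fun δ =>
    { toFun := fun u => ⟨fun γ => u.1 (δ⁻¹ * γ), fun γ p => by simpa only [mul_assoc] using u.2 (_ * γ) p⟩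
      invFun := fun u => ⟨fun γ => u.1 (δ * γ), fun γ p => by simpa only [mul_assoc] using u.2 (_ * γ) p⟩
      left_inv := fun u => by ext; simp
      right_inv := fun u => by ext; simp
      map_mul' := fun u v => rfl }
  map_one' := by ext; simp
  map_mul' := fun δ ε => by ext; simp [mul_assoc]

@[simp]
theorem act_apply (δ : Γ) (u : coind ι α) (γ : Γ) : (act ι α δ u).1 γ = u.1 (δ⁻¹ * γ) := rfl

/-- Evaluation at `1`. -/
def ev (ι : P →* Γ) (α : P →* MulAut A) : coind ι α →* A where
  toFun := fun u => u.1 1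
  map_one' := rfl
  map_mul' := fun _ _ => rfl

theorem ev_act (p : P) (u : coind ι α) : ev ι α (act ι α (ι p) u) = α p (ev ι α u) := by
  have := u.2 1 p⁻¹
  simpa [ev] using this

open Classical in
/-- The functions in the coinduced group that are supported on the range of `ι`. -/
noncomputable def single (hι : Function.Injective ι) (α : P →* MulAut A) : A →* coind ι α where
  toFun := fun s => ⟨fun γ => if h : ∃ p, ι p = γ then (α h.choose)⁻¹ s else 1, fun γ p => by
    by_cases h : ∃ q, ι q = γ
    · obtain ⟨q, rfl⟩ := h
      have h1 : ∃ q', ι q' = ι q := ⟨q, rfl⟩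
      have h2 : ∃ q', ι q' = ι q * ι p := ⟨q * p, map_mul _ _ _⟩
      have e1 : h1.choose = q := hι h1.choose_spec
      have e2 : h2.choose = q * p := hι (by rw [h2.choose_spec, map_mul])
      beta_reduce
      rw [dif_pos h1, dif_pos h2, e1, e2]
      simp
    · have h2 : ¬ ∃ q', ι q' = γ * ι p := fun ⟨q, hq⟩ => h ⟨q * p⁻¹, by simp [hq]⟩
      beta_reduce
      rw [dif_neg h, dif_neg h2, map_one]⟩
  map_one' := by ext γ; by_cases h : ∃ p, ι p = γ <;> simp [h]
  map_mul' := fun s t => by ext γ; by_cases h : ∃ p, ι p = γ <;> simp [h]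

theorem single_apply_range (hι : Function.Injective ι) (s : A) (p : P) :
    (single hι α s).1 (ι p) = (α p)⁻¹ s := by
  have h1 : ∃ q', ι q' = ι p := ⟨p, rfl⟩
  have e1 : h1.choose = p := hι h1.choose_spec
  simp only [single, MonoidHom.coe_mk, OneHom.coe_mk]
  rw [dif_pos h1, e1]

theorem single_apply_notMem (hι : Function.Injective ι) (s : A) {γ : Γ} (h : ¬ ∃ p, ι p = γ) :
    (single hι α s).1 γ = 1 := by
  simp only [single, MonoidHom.coe_mk, OneHom.coe_mk]
  rw [dif_neg h]

theorem ev_single (hι : Function.Injective ι) (s : A) : ev ι α (single hι α s) = s := by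
  have := single_apply_range (α := α) hι s 1
  simpa [ev] using this

theorem act_single (hι : Function.Injective ι) (p : P) (s : A) :
    act ι α (ι p) (single hι α s) = single hι α (α p s) := by
  ext γ
  rw [act_apply]
  by_cases h : ∃ q, ι q = γ
  · obtain ⟨q, rfl⟩ := h
    rw [← map_inv, ← map_mul, single_apply_range, single_apply_range]
    simp
  · rw [single_apply_notMem hι _ h, single_apply_notMem]
    rintro ⟨q, hq⟩
    exact h ⟨p * q, by simp [hq]⟩

/-- Conjugation is pointwise, and on the range of `ι` equivariance determines `u` by its value at
`1`. -/
theorem conj_single (hι : Function.Injective ι) (u : coind ι α) (s : A) :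
    u * single hι α s * u⁻¹ = single hι α (ev ι α u * s * (ev ι α u)⁻¹) := by
  ext γ
  change u.1 γ * (single hι α s).1 γ * (u.1 γ)⁻¹ = _
  by_cases h : ∃ q, ι q = γ
  · obtain ⟨q, rfl⟩ := h
    have := u.2 1 q
    rw [one_mul] at this
    rw [single_apply_range, single_apply_range, this]
    simp [ev]
  · rw [single_apply_notMem hι _ h, single_apply_notMem hι _ h]
    simp

end coind

/-! ### Covers with isomorphic preimages -/

/-- Automorphisms of two groups act on their product. -/
def prodAut (A B : Type*) [Group A] [Group B] : MulAut A × MulAut B →* MulAut (A × B) where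
  toFun := fun x => MulEquiv.prodCongr x.1 x.2
  map_one' := rfl
  map_mul' := fun _ _ => rfl

/-- A group is the product of the set of left cosets and the subgroup, through the chosen
representatives of the cosets. -/
noncomputable def cosetProdEquiv {P : Type*} [Group P] (Q : Subgroup P) : (P ⧸ Q) × Q ≃ P where
  toFun := fun x => x.1.out * x.2
  invFun := fun g => (g, ⟨(g : P ⧸ Q).out⁻¹ * g, QuotientGroup.eq.1 (QuotientGroup.out_eq' _)⟩)
  left_inv := fun ⟨q, h⟩ => by
    have : ((q.out * h : P) : P ⧸ Q) = q := by
      rw [QuotientGroup.mk_mul_of_mem _ h.2, QuotientGroup.out_eq']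
    ext <;> simp [this]
  right_inv := fun g => by simp

theorem cosetProdEquiv_mul {P : Type*} [Group P] (Q : Subgroup P) (q : P ⧸ Q) (h k : Q) :
    cosetProdEquiv Q (q, h * k) = cosetProdEquiv Q (q, h) * k := by
  simp [cosetProdEquiv, mul_assoc]

/-- Isomorphic subgroups of a finite group are conjugate in its symmetric group, when the group
acts by translations. -/
theorem exists_perm_mul {P : Type*} [Group P] [Finite P] {P₁ P₂ : Subgroup P} (φ : P₁ ≃* P₂) :
    ∃ t : Equiv.Perm P, ∀ (x : P) (p : P₁), t (x * p) = t x * φ p := by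
  have hc : Nat.card (P ⧸ P₁) = Nat.card (P ⧸ P₂) := by
    have h1 := P₁.card_eq_card_quotient_mul_card_subgroup
    have h2 := P₂.card_eq_card_quotient_mul_card_subgroup
    rw [Nat.card_congr φ.toEquiv, h2] at h1
    exact (Nat.eq_of_mul_eq_mul_right Nat.card_pos h1).symm
  obtain ⟨e⟩ := (Finite.card_eq).1 hc
  refine ⟨(cosetProdEquiv P₁).symm.trans ((Equiv.prodCongr e φ.toEquiv).trans
    (cosetProdEquiv P₂)), fun x p => ?_⟩
  obtain ⟨⟨q, h⟩, rfl⟩ := (cosetProdEquiv P₁).surjective x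
  rw [← cosetProdEquiv_mul]
  simp only [Equiv.trans_apply, Equiv.symm_apply_apply]
  change cosetProdEquiv P₂ (e q, φ (h * p)) = cosetProdEquiv P₂ (e q, φ h) * _
  rw [map_mul, cosetProdEquiv_mul]

/-- The action of a group on itself by right translations. -/
def rightTranslation (P : Type*) [Group P] : P →* Equiv.Perm P where
  toFun := fun p => Equiv.mulRight p⁻¹
  map_one' := by ext; simp
  map_mul' := fun p q => by ext; simp [mul_assoc]

theorem rightTranslation_injective (P : Type*) [Group P] :
    Function.Injective (rightTranslation P) := fun p q h => by
  have := DFunLike.congr_fun h 1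
  simpa [rightTranslation] using this

/-- A homomorphism from a semidirect product `X ⋊ P` built from a homomorphism `f : P →* R` and a
`P`-equivariant retraction of `X` onto a normal subgroup `S` of `R`. -/
theorem exists_semidirect_hom {X P R : Type*} [Group X] [Group P] [Group R] (θ : P →* MulAut X)
    (f : P →* R) (S : Subgroup R) [S.Normal] (hS : S ⊔ f.range = ⊤) (π : X →* S) (σ : S →* X)
    (hπσ : ∀ s, π (σ s) = s) (hπ : ∀ p x, π (θ p x) = MulAut.conjNormal (f p) (π x))
    (hσ : ∀ p s, θ p (σ s) = σ (MulAut.conjNormal (f p) s))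
    (hconj : ∀ x s, x * σ s * x⁻¹ = σ (π x * s * (π x)⁻¹)) :
    ∃ g : X ⋊[θ] P →* R, Function.Surjective g ∧ (∀ y, g y ∈ S ↔ f y.right ∈ S) ∧
      ∀ T ≤ S, Nonempty (T.comap g ≃* T × g.ker) := by
  let g : X ⋊[θ] P →* R := SemidirectProduct.lift (S.subtype.comp π) f (fun p => by
    ext x; simp [hπ])
  have hg : ∀ y, g y = π y.left * f y.right := fun y => rfl
  refine ⟨g, ?_, fun y => ?_, fun T hT => ?_⟩
  · intro r
    have hr : r ∈ S ⊔ f.range := hS ▸ Subgroup.mem_top r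
    obtain ⟨s, hs, _, ⟨p, rfl⟩, rfl⟩ := Subgroup.mem_sup_of_normal_left.1 hr
    exact ⟨⟨σ ⟨s, hs⟩, p⟩, by rw [hg]; simp [hπσ]⟩
  · rw [hg]; exact Subgroup.mul_mem_cancel_left _ (π y.left).2
  · refine comap_equiv_prod_ker g S T hT (SemidirectProduct.inl.comp σ)
      (fun s => by simp [hg, hπσ]) fun s k hk => ?_
    rw [MonoidHom.mem_ker, hg] at hk
    -- For `k = (x, p)` in the kernel, `π x = (f p)⁻¹`, so the actions of `x` and `p` on `σ s`
    -- cancel.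
    have hconj' : k * SemidirectProduct.inl (σ s) * k⁻¹ = SemidirectProduct.inl (σ s) := by
      have h1 : k * SemidirectProduct.inl (σ s) * k⁻¹ =
          SemidirectProduct.inl (k.left * θ k.right (σ s) * (k.left)⁻¹) := by
        ext <;> simp
      rw [h1, hσ, hconj]
      congr 2
      ext
      have : (π k.left : R) = (f k.right)⁻¹ := eq_inv_of_mul_eq_one_left hk
      simp [this, mul_assoc]
    exact (mul_inv_eq_iff_eq_mul.1 hconj').symm

/-- Two surjections from one finite group with isomorphic preimages of given normal subgroups. -/
theorem exists_cover_of_equiv {P R₁ R₂ : Type} [Group P] [Group R₁] [Group R₂] [Finite P]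
    [Finite R₁] [Finite R₂] (f₁ : P →* R₁) (f₂ : P →* R₂)
    (S₁ T₁ : Subgroup R₁) (S₂ T₂ : Subgroup R₂) [S₁.Normal] [S₂.Normal]
    (h₁ : S₁ ⊔ f₁.range = ⊤) (h₂ : S₂ ⊔ f₂.range = ⊤)
    (φ : S₁.comap f₁ ≃* S₂.comap f₂) (hT₁ : T₁ ≤ S₁) (hT₂ : T₂ ≤ S₂)
    (eS : S₁ ≃* S₂) (eT : T₁ ≃* T₂) :
    ∃ (G : Type) (_ : Group G) (_ : Finite G) (g₁ : G →* R₁) (g₂ : G →* R₂),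
      Function.Surjective g₁ ∧ Function.Surjective g₂ ∧
      Nonempty (T₁.comap g₁ ≃* T₂.comap g₂) := by
  obtain ⟨t, ht⟩ := exists_perm_mul φ
  let ι := rightTranslation P
  have hι : Function.Injective ι := rightTranslation_injective P
  have hconj : ∀ p : S₁.comap f₁, t * ι p = ι (φ p) * t := fun p => by
    ext x
    simpa [ι, rightTranslation] using ht x p⁻¹
  let α₁ : P →* MulAut S₁ := MulAut.conjNormal.comp f₁
  let α₂ : P →* MulAut S₂ := MulAut.conjNormal.comp f₂
  -- Both factors are coinduced at once, so that a single semidirect product maps onto `R₁` and onto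
  -- `R₂`.
  let α : P →* MulAut (S₁ × S₂) := (prodAut S₁ S₂).comp (α₁.prod α₂)
  let act := coind.act ι α
  let θ : P →* MulAut (coind ι α) := act.comp ι
  obtain ⟨g₁, hg₁, hm₁, hk₁⟩ := exists_semidirect_hom θ f₁ S₁ h₁
    ((MonoidHom.fst S₁ S₂).comp (coind.ev ι α)) ((coind.single hι α).comp (MonoidHom.inl S₁ S₂))
    (fun s => by simp [coind.ev_single])
    (fun p x => by
      change (coind.ev ι α (act (ι p) x)).1 = _
      rw [coind.ev_act]; rfl)
    (fun p s => by
      change act (ι p) (coind.single hι α _) = coind.single hι α _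
      rw [coind.act_single]
      congr 1
      exact Prod.ext rfl (map_one (α₂ p)))
    (fun x s => by
      simp only [MonoidHom.comp_apply]
      rw [coind.conj_single]
      congr 1
      ext <;> simp)
  obtain ⟨g₂, hg₂, hm₂, hk₂⟩ := exists_semidirect_hom θ f₂ S₂ h₂
    ((MonoidHom.snd S₁ S₂).comp (coind.ev ι α)) ((coind.single hι α).comp (MonoidHom.inr S₁ S₂))
    (fun s => by simp [coind.ev_single])
    (fun p x => by
      change (coind.ev ι α (act (ι p) x)).2 = _
      rw [coind.ev_act]; rfl)
    (fun p s => by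
      change act (ι p) (coind.single hι α _) = coind.single hι α _
      rw [coind.act_single]
      congr 1
      exact Prod.ext (map_one (α₁ p)) rfl)
    (fun x s => by
      simp only [MonoidHom.comp_apply]
      rw [coind.conj_single]
      congr 1
      ext <;> simp)
  -- `φ` need not extend to `P`: on the coinduced group, `t` intertwines the actions of `p` and `φ
  -- p`.
  have hθ : ∀ (p : S₁.comap f₁) (x : coind ι α), act t (θ p x) = θ (φ p) (act t x) := by
    intro p x
    change (act t * act (ι p)) x = (act (ι (φ p)) * act t) x
    rw [← map_mul, hconj, map_mul]
  let H : S₁.comap g₁ →* S₂.comap g₂ :=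
    { toFun := fun y => ⟨⟨act t y.1.left, φ ⟨y.1.right, (hm₁ _).1 y.2⟩⟩, (hm₂ _).2 (φ _).2⟩
      map_one' := by
        ext1
        refine SemidirectProduct.ext (map_one _) ?_
        exact congrArg Subtype.val (map_one φ)
      map_mul' := fun x y => by
        ext1
        refine SemidirectProduct.ext ?_ ?_
        · simp only [Subgroup.coe_mul, SemidirectProduct.mul_left, map_mul]
          rw [← hθ ⟨x.1.right, (hm₁ _).1 x.2⟩]
        · exact congrArg Subtype.val (map_mul φ ⟨x.1.right, (hm₁ _).1 x.2⟩
            ⟨y.1.right, (hm₁ _).1 y.2⟩) }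
  have hH : Function.Bijective H := by
    constructor
    · intro x y hxy
      have h := congrArg Subtype.val hxy
      have hl := (act t).injective (congrArg SemidirectProduct.left h)
      have hr := congrArg Subtype.val (φ.injective (Subtype.ext (congrArg SemidirectProduct.right h)))
      exact Subtype.ext (SemidirectProduct.ext hl hr)
    · rintro ⟨⟨x, p⟩, hy⟩
      obtain ⟨q, hq⟩ := φ.surjective ⟨p, (hm₂ _).1 hy⟩
      refine ⟨⟨⟨(act t).symm x, q⟩, (hm₁ _).2 q.2⟩, ?_⟩
      ext1
      refine SemidirectProduct.ext ((act t).apply_symm_apply x) ?_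
      exact congrArg Subtype.val hq
  obtain ⟨a₁⟩ := hk₁ S₁ le_rfl
  obtain ⟨a₂⟩ := hk₂ S₂ le_rfl
  obtain ⟨b₁⟩ := hk₁ T₁ hT₁
  obtain ⟨b₂⟩ := hk₂ T₂ hT₂
  -- To use this without cancelling `Sᵢ`, the cover receives an extra factor `S₁ ≅ S₂`, which pairs
  -- with the kernel.
  have c : S₁ × g₁.ker ≃* S₂ × g₂.ker := (a₁.symm.trans (MulEquiv.ofBijective H hH)).trans a₂
  have comap_fst : ∀ {G K R : Type} [Group G] [Group K] [Group R] (g : G →* R) (T : Subgroup R),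
      Nonempty (T.comap (g.comp (MonoidHom.fst G K)) ≃* T.comap g × K) := fun g T =>
    ⟨{ toFun := fun y => (⟨y.1.1, y.2⟩, y.1.2)
       invFun := fun y => ⟨(y.1.1, y.2), y.1.2⟩
       left_inv := fun _ => rfl
       right_inv := fun _ => rfl
       map_mul' := fun _ _ => rfl }⟩
  obtain ⟨d₁⟩ := comap_fst (K := S₁) g₁ T₁
  obtain ⟨d₂⟩ := comap_fst (K := S₁) g₂ T₂
  have : Finite (coind ι α ⋊[θ] P) := Finite.of_equiv _ SemidirectProduct.equivProd.symm
  refine ⟨(coind ι α ⋊[θ] P) × S₁, inferInstance, inferInstance, g₁.comp (MonoidHom.fst _ _),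
    g₂.comp (MonoidHom.fst _ _), hg₁.comp Prod.fst_surjective, hg₂.comp Prod.fst_surjective, ⟨?_⟩⟩
  have key : ∀ {A B C : Type} [Group A] [Group B] [Group C], (A × B) × C ≃* A × (C × B) :=
    MulEquiv.prodAssoc.trans (MulEquiv.prodCongr (MulEquiv.refl _) MulEquiv.prodComm)
  exact (((d₁.trans (MulEquiv.prodCongr b₁ (MulEquiv.refl _))).trans key).trans
    (MulEquiv.prodCongr eT c)).trans (((d₂.trans
      (MulEquiv.prodCongr b₂ eS)).trans key).symm)

/-! ### Schreier's index formula by double counting -/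

section SchreierIndex

variable {ι A : Type*} [CommGroup A] (S : Subgroup (FreeGroup ι))

/-- Functions on the free group that transform by a character of `S` under right translations. -/
def rightQuasiChar (S : Subgroup (FreeGroup ι)) (A : Type*) [CommGroup A] :
    Set (FreeGroup ι → A) :=
  {u | ∀ g h, ∀ s ∈ S, u (g * s) / u g = u (h * s) / u h}

/-- The character of `S` and the values at coset representatives are free parameters. -/
theorem rightQuasiChar_equiv_hom :
    Nonempty ((S →* A) × (FreeGroup ι ⧸ S → A) ≃ rightQuasiChar S A) := by
  let E := cosetProdEquiv S
  let v : (S →* A) × (FreeGroup ι ⧸ S → A) → FreeGroup ι → A :=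
    fun x g => x.2 (E.symm g).1 * x.1 (E.symm g).2
  have hv : ∀ x q h, v x (E (q, h)) = x.2 q * x.1 h := fun x q h => by simp [v]
  have hr : ∀ x g (s : S), v x (g * s) / v x g = x.1 s := fun x g s => by
    obtain ⟨⟨q, h⟩, rfl⟩ := E.surjective g
    rw [← cosetProdEquiv_mul, hv, hv, map_mul]
    simp [← mul_assoc]
  refine ⟨Equiv.ofBijective
    (fun x => ⟨v x, fun g h s hs => (hr x g ⟨s, hs⟩).trans (hr x h ⟨s, hs⟩).symm⟩) ⟨?_, ?_⟩⟩
  · intro x y hxy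
    have hxy : v x = v y := congrArg Subtype.val hxy
    have h1 : x.1 = y.1 := by
      ext s
      rw [← hr x 1 s, hxy, hr]
    refine Prod.ext h1 (funext fun q => ?_)
    have := congrFun hxy (E (q, 1))
    simpa [hv] using this
  · rintro ⟨u, hu⟩
    let χ : S →* A :=
      { toFun := fun s => u s / u 1
        map_one' := by simp
        map_mul' := fun s t => by
          have := hu s 1 t t.2
          rw [one_mul] at this
          rw [← this, Subgroup.coe_mul, mul_comm, div_mul_div_cancel] }
    refine ⟨(χ, fun q => u q.out), Subtype.ext (funext fun g => ?_)⟩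
    obtain ⟨⟨q, h⟩, rfl⟩ := E.surjective g
    change v _ _ = _
    rw [hv]
    have := hu q.out 1 h h.2
    rw [one_mul] at this
    change u q.out * (u h / u 1) = u (q.out * h)
    rw [← this, mul_div_cancel]

/-- The ratio `u (k * g) / u g` depends on `g` only through its coset and is a cocycle in `k`. On a
free group a cocycle is determined by arbitrary values at the generators. -/
theorem rightQuasiChar_equiv_fun :
    Nonempty (rightQuasiChar S A ≃ A × (ι → FreeGroup ι ⧸ S → A)) := by
  have hcos : ∀ u ∈ rightQuasiChar S A, ∀ k g g' : FreeGroup ι,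
      (g : FreeGroup ι ⧸ S) = g' → u (k * g) / u g = u (k * g') / u g' := by
    intro u hu k g g' h
    have := hu (k * g) g _ (QuotientGroup.eq.1 h)
    rw [mul_assoc, mul_inv_cancel_left] at this
    rw [div_eq_div_iff_mul_eq_mul] at this ⊢
    rw [mul_comm, ← this]
  refine ⟨Equiv.ofBijective (fun u =>
    (u.1 1, fun i x => u.1 (FreeGroup.of i * x.out) / u.1 x.out)) ⟨?_, ?_⟩⟩
  · rintro ⟨u, hu⟩ ⟨v, hv⟩ huv
    simp only [Prod.mk.injEq] at huv
    have key : ∀ k g : FreeGroup ι, u (k * g) / u g = v (k * g) / v g := by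
      intro k
      have hof : ∀ i (g : FreeGroup ι),
          u (FreeGroup.of i * g) / u g = v (FreeGroup.of i * g) / v g := fun i g => by
        have h := congrFun (congrFun huv.2 i) (g : FreeGroup ι ⧸ S)
        have ho : ((g : FreeGroup ι ⧸ S).out : FreeGroup ι ⧸ S) = g := QuotientGroup.out_eq' _
        rwa [hcos u hu _ _ _ ho, hcos v hv _ _ _ ho] at h
      induction k using FreeGroup.induction_on with
      | C1 => simp
      | of i => exact hof i
      | inv_of i _ =>
        intro g
        have := hof i ((FreeGroup.of i)⁻¹ * g)
        rw [mul_inv_cancel_left] at this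
        rw [← inv_div, this, inv_div]
      | mul x y hx hy =>
        intro g
        rw [mul_assoc, ← div_mul_div_cancel _ (u (y * g)), hx, hy, div_mul_div_cancel]
    refine Subtype.ext (funext fun g => ?_)
    have := key g 1
    rw [mul_one, huv.1] at this
    exact div_left_injective this
  · rintro ⟨a, c⟩
    -- The cocycle with prescribed values is the left component of a homomorphism to a semidirect
    -- product, which exists by freeness.
    let f : FreeGroup ι →* (FreeGroup ι ⧸ S → A) ⋊[mulAutArrow] FreeGroup ι :=
      FreeGroup.lift fun i => ⟨fun x => c i ((FreeGroup.of i)⁻¹ • x), FreeGroup.of i⟩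
    have hright : ∀ g, (f g).right = g := by
      have : SemidirectProduct.rightHom.comp f = MonoidHom.id _ := by
        ext i; simp [f]
      exact DFunLike.congr_fun this
    have hmul : ∀ (g h : FreeGroup ι) (x : FreeGroup ι ⧸ S),
        (f (g * h)).left (g • x) = (f g).left (g • x) * (f h).left x := by
      intro g h x
      rw [map_mul, SemidirectProduct.mul_left, hright]
      change _ * (f h).left (g⁻¹ • g • x) = _
      rw [inv_smul_smul]
    let u : FreeGroup ι → A := fun g => a * (f g).left g
    have hS : ∀ s ∈ S, ((s : FreeGroup ι) : FreeGroup ι ⧸ S) = (1 : FreeGroup ι) := fun s hs =>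
      QuotientGroup.eq.2 (by simpa using hs)
    refine ⟨⟨u, ?_⟩, ?_⟩
    · have h1 : ∀ g, ∀ s ∈ S, u (g * s) / u g = (f s).left (1 : FreeGroup ι) := by
        intro g s hs
        have h := hmul g s s
        have h2 : g • (s : FreeGroup ι ⧸ S) = (g : FreeGroup ι) := by
          rw [hS s hs]; change ((g * 1 : FreeGroup ι) : FreeGroup ι ⧸ S) = _; rw [mul_one]
        have h3 : ((g * s : FreeGroup ι) : FreeGroup ι ⧸ S) = g := h2
        rw [h2, hS s hs] at h
        change a * (f (g * s)).left (g * s : FreeGroup ι) / (a * (f g).left g) = _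
        rw [h3, h]
        simp [← mul_assoc]
      intro g h s hs
      rw [h1 g s hs, h1 h s hs]
    · refine Prod.ext ?_ (funext fun i => funext fun x => ?_)
      · change a * (f 1).left _ = a
        simp
      · have h := hmul (FreeGroup.of i) x.out x.out
        change a * (f (FreeGroup.of i * x.out)).left (FreeGroup.of i • (x.out : FreeGroup ι ⧸ S)) /
          (a * (f x.out).left x.out) = c i x
        rw [h]
        have : (f (FreeGroup.of i)).left (FreeGroup.of i • (x.out : FreeGroup ι ⧸ S)) = c i x := by
          simp [f]
        rw [this]
        simp [← mul_assoc]

end SchreierIndex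

/-- **Schreier's index formula**: a subgroup of index `m` in a free group of rank `d` is free of
rank `1 + m * d - m`. -/
theorem exists_basis_of_finiteIndex {ι : Type} [Finite ι] (S : Subgroup (FreeGroup ι))
    [S.FiniteIndex] :
    ∃ n, Nonempty (FreeGroupBasis (Fin n) S) ∧ n + S.index = 1 + S.index * Nat.card ι := by
  -- Any finite nontrivial `A` would do: comparing exponents of its order gives the formula, and
  -- finiteness of the count bounds the rank.
  let A := Multiplicative (ZMod 2)
  have hA : Nat.card A = 2 := by simp [A]
  have : Finite A := Nat.finite_of_card_ne_zero (by omega)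
  have : Nontrivial A := Finite.one_lt_card_iff_nontrivial.1 (by omega)
  obtain ⟨e₁⟩ := rightQuasiChar_equiv_hom (A := A) S
  obtain ⟨e₂⟩ := rightQuasiChar_equiv_fun (A := A) S
  let b := IsFreeGroup.basis S
  let e := (Equiv.prodCongr (b.lift (H := A)) (Equiv.refl (FreeGroup ι ⧸ S → A))).trans
    (e₁.trans e₂)
  have : Finite ((IsFreeGroup.Generators S → A) × (FreeGroup ι ⧸ S → A)) := Finite.of_equiv _ e.symm
  have : Finite (IsFreeGroup.Generators S → A) := Finite.of_surjective _ (Prod.fst_surjective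
    (β := FreeGroup ι ⧸ S → A))
  have : Finite (IsFreeGroup.Generators S) := by
    by_contra h
    rw [not_finite_iff_infinite] at h
    exact not_finite (IsFreeGroup.Generators S → A)
  refine ⟨_, ⟨b.reindex (Finite.equivFin _)⟩, ?_⟩
  have hc := Nat.card_congr e
  rw [Nat.card_prod, Nat.card_prod, Nat.card_fun, Nat.card_fun, Nat.card_fun, Nat.card_fun, hA,
    ← pow_add, ← pow_mul, ← pow_succ'] at hc
  have := Nat.pow_right_injective le_rfl hc
  rw [Subgroup.index]
  omega

/-! ### Subgroups of prime index in free groups -/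

/-- The exponent sum of the generator `j`. -/
def exponentSum {κ : Type*} [DecidableEq κ] (j : κ) : FreeGroup κ →* Multiplicative ℤ :=
  FreeGroup.lift (Pi.mulSingle j (Multiplicative.ofAdd 1))

/-- The automorphism of a free group multiplying each generator `i ≠ j` by a power of `j`. -/
def transvection {κ : Type*} [DecidableEq κ] (j : κ) (k : κ → ℤ) (hk : k j = 0) :
    FreeGroup κ ≃* FreeGroup κ :=
  MonoidHom.toMulEquiv
    (FreeGroup.lift fun i => FreeGroup.of i * FreeGroup.of j ^ k i)
    (FreeGroup.lift fun i => FreeGroup.of i * FreeGroup.of j ^ (- k i))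
    (by ext i; simp [hk]) (by ext i; simp [hk])

/-- Some generator has nontrivial image `c` in the quotient, and `c` generates it. Swap that
generator with `j`, then correct the others by powers of `j` until their images vanish. -/
theorem exists_aut_forall_mem_iff {κ : Type*} [DecidableEq κ] (j : κ) {p : ℕ} (hp : p.Prime)
    (T : Subgroup (FreeGroup κ)) [T.Normal] (hT : T.index = p) :
    ∃ ε : FreeGroup κ ≃* FreeGroup κ, ∀ x, ε x ∈ T ↔ (p : ℤ) ∣ (exponentSum j x).toAdd := by
  have : Fact p.Prime := ⟨hp⟩
  have hcard : Nat.card (FreeGroup κ ⧸ T) = p := hT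
  let q := QuotientGroup.mk' T
  obtain ⟨i₀, hi₀⟩ : ∃ i, q (FreeGroup.of i) ≠ 1 := by
    by_contra! h
    have hq : q = 1 := by ext i; exact h i
    have : T = ⊤ := by rw [← QuotientGroup.ker_mk' T]; change q.ker = ⊤; rw [hq]; simp
    rw [this, Subgroup.index_top] at hT
    exact hp.one_lt.ne hT
  let ε₁ : FreeGroup κ ≃* FreeGroup κ := FreeGroup.freeGroupCongr (Equiv.swap j i₀)
  let c := q (FreeGroup.of i₀)
  have hmem : ∀ y : FreeGroup κ ⧸ T, ∃ k : ℤ, c ^ k = y := fun y =>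
    Subgroup.mem_zpowers_iff.1 (mem_zpowers_of_prime_card hcard hi₀)
  choose m hm using fun i => hmem (q (ε₁ (FreeGroup.of i)))
  let ε₂ := transvection j (fun i => if i = j then 0 else - m i) (by simp)
  have hj : q (ε₁ (FreeGroup.of j)) = c := by simp [ε₁, c]
  have hcomp : (q.comp ε₁.toMonoidHom).comp ε₂.toMonoidHom =
      (zpowersHom _ c).comp (exponentSum j) := by
    ext i
    by_cases hi : i = j
    · subst hi
      simp only [MonoidHom.comp_apply]
      change q (ε₁ (ε₂ _)) = _
      simp [ε₂, transvection, exponentSum, hj]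
    · simp only [MonoidHom.comp_apply]
      change q (ε₁ (ε₂ _)) = _
      simp [ε₂, transvection, exponentSum, hi, hj, ← hm]
  refine ⟨ε₂.trans ε₁, fun x => ?_⟩
  have h := DFunLike.congr_fun hcomp x
  have h1 : q (ε₁ (ε₂ x)) = c ^ (exponentSum j x).toAdd := h
  rw [MulEquiv.trans_apply, ← QuotientGroup.eq_one_iff]
  change q (ε₁ (ε₂ x)) = 1 ↔ _
  have hc : c ^ p = 1 := by rw [← hcard]; exact pow_card_eq_one'
  rw [h1, ← orderOf_dvd_iff_zpow_eq_one, orderOf_eq_prime hc hi₀]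

/-- Free groups of the same rank have isomorphic pairs of subgroups of the same prime index. -/
theorem exists_equiv_forall_mem_iff {n : ℕ} {S₁ S₂ : Type*} [Group S₁] [Group S₂]
    (b₁ : FreeGroupBasis (Fin n) S₁) (b₂ : FreeGroupBasis (Fin n) S₂) {p : ℕ} (hp : p.Prime)
    (T₁ : Subgroup S₁) (T₂ : Subgroup S₂) [T₁.Normal] [T₂.Normal]
    (h₁ : T₁.index = p) (h₂ : T₂.index = p) :
    ∃ e : S₁ ≃* S₂, ∀ x, e x ∈ T₂ ↔ x ∈ T₁ := by
  have i₁ : (T₁.comap b₁.repr.symm.toMonoidHom).index = p := by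
    rw [Subgroup.index_comap_of_surjective _ b₁.repr.symm.surjective, h₁]
  have i₂ : (T₂.comap b₂.repr.symm.toMonoidHom).index = p := by
    rw [Subgroup.index_comap_of_surjective _ b₂.repr.symm.surjective, h₂]
  have hn : 0 < n := by
    by_contra! hn
    obtain rfl : n = 0 := by omega
    have : Subsingleton S₁ := b₁.repr.toEquiv.subsingleton
    rw [Subsingleton.elim T₁ ⊤, Subgroup.index_top] at h₁
    exact hp.one_lt.ne h₁
  obtain ⟨ε₁, hε₁⟩ := exists_aut_forall_mem_iff (⟨0, hn⟩ : Fin n) hp _ i₁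
  obtain ⟨ε₂, hε₂⟩ := exists_aut_forall_mem_iff (⟨0, hn⟩ : Fin n) hp _ i₂
  refine ⟨((b₁.repr.trans ε₁.symm).trans ε₂).trans b₂.repr.symm, fun x => ?_⟩
  have e₁ := hε₁ (ε₁.symm (b₁.repr x))
  have e₂ := hε₂ (ε₁.symm (b₁.repr x))
  rw [← e₁] at e₂
  simpa using e₂

/-! ### Finite quotients of free covers -/

/-- The intersection of the kernels of all homomorphisms from `S` to `H`. -/
def homKer (S H : Type*) [Group S] [Group H] : Subgroup S := ⨅ χ : S →* H, χ.ker

theorem mem_homKer {S H : Type*} [Group S] [Group H] {x : S} :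
    x ∈ homKer S H ↔ ∀ χ : S →* H, χ x = 1 := by
  simp [homKer, Subgroup.mem_iInf, MonoidHom.mem_ker]

theorem mem_homKer_equiv {S S' H : Type*} [Group S] [Group S'] [Group H] (e : S ≃* S') {x : S} :
    e x ∈ homKer S' H ↔ x ∈ homKer S H := by
  rw [mem_homKer, mem_homKer]
  constructor
  · intro h χ
    simpa using h (χ.comp e.symm.toMonoidHom)
  · intro h χ
    exact h (χ.comp e.toMonoidHom)

instance {S H : Type*} [Group S] [Group H] : (homKer S H).Characteristic :=
  ⟨fun e => by ext x; exact mem_homKer_equiv e⟩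

theorem homKer_finiteIndex {S H κ : Type*} [Group S] [Group H] [Finite H] [Finite κ]
    (b : FreeGroupBasis κ S) : (homKer S H).FiniteIndex := by
  have : Finite (S →* H) := Finite.of_equiv _ b.lift
  have : ∀ χ : S →* H, χ.ker.FiniteIndex := fun χ => inferInstance
  exact Subgroup.finiteIndex_iInf this

theorem exists_equiv_of_surjective {A A' B B' : Type*} [Group A] [Group A'] [Group B] [Group B']
    (q : A →* B) (q' : A' →* B') (hq : Function.Surjective q) (hq' : Function.Surjective q')
    (e : A ≃* A') (h : ∀ x, q' (e x) = 1 ↔ q x = 1) : ∃ e' : B ≃* B', ∀ x, e' (q x) = q' (e x) := by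
  have hker : q.ker.map (e : A →* A') = q'.ker := by
    ext y
    obtain ⟨x, rfl⟩ := e.surjective y
    rw [MonoidHom.mem_ker, h, ← MonoidHom.mem_ker]
    exact Subgroup.mem_map_iff_mem e.injective
  refine ⟨((QuotientGroup.quotientKerEquivOfSurjective q hq).symm.trans
    (QuotientGroup.congr _ _ e hker)).trans (QuotientGroup.quotientKerEquivOfSurjective q' hq'),
    fun x => ?_⟩
  have : (QuotientGroup.quotientKerEquivOfSurjective q hq).symm (q x) = (x : A ⧸ q.ker) :=
    (MulEquiv.symm_apply_eq _).2 rfl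
  rw [MulEquiv.trans_apply, MulEquiv.trans_apply, this]
  rfl

theorem nonempty_equiv_of_mem_iff {R₁ R₂ : Type*} [Group R₁] [Group R₂] {S₁ T₁ : Subgroup R₁}
    {S₂ T₂ : Subgroup R₂} (h₁ : T₁ ≤ S₁) (h₂ : T₂ ≤ S₂) (e : S₁ ≃* S₂)
    (h : ∀ x, (e x : R₂) ∈ T₂ ↔ (x : R₁) ∈ T₁) : Nonempty (T₁ ≃* T₂) := by
  have hm : (T₁.subgroupOf S₁).map (e : S₁ →* S₂) = T₂.subgroupOf S₂ := by
    ext y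
    obtain ⟨x, rfl⟩ := e.surjective y
    rw [Subgroup.mem_subgroupOf, h, ← Subgroup.mem_subgroupOf]
    exact Subgroup.mem_map_iff_mem e.injective
  exact ⟨((Subgroup.subgroupOfEquivOfLe h₁).symm.trans ((e.subgroupMap _).trans
    (MulEquiv.subgroupCongr hm))).trans (Subgroup.subgroupOfEquivOfLe h₂)⟩

/-- The quotient of a free cover of a finite group `R` by the `homKer` of the preimage of a
normal subgroup. -/
theorem exists_cover_of_free {F R H : Type} [Group F] [Group R] [Group H] [Finite R] [Finite H]
    (ψ : F →* R) (hψ : Function.Surjective ψ) (j : R →* H) (hj : Function.Injective j)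
    (S : Subgroup R) [S.Normal] {n : ℕ} (b : FreeGroupBasis (Fin n) (S.comap ψ)) :
    ∃ (R' : Type) (_ : Group R') (_ : Finite R') (π : R' →* R) (q : S.comap ψ →* S.comap π),
      Function.Surjective π ∧ Function.Surjective q ∧ (∀ x, π (q x) = ψ x) ∧
      ∀ x, q x = 1 ↔ x ∈ homKer (S.comap ψ) H := by
  -- `V` is normal, being characteristic in a normal subgroup, and `ψ` kills it since `j` embeds `R`
  -- in `H`.
  let V := (homKer (S.comap ψ) H).map (S.comap ψ).subtype
  have hV : V.Normal := inferInstance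
  have hVψ : ∀ x ∈ V, ψ x = 1 := by
    rintro _ ⟨x, hx, rfl⟩
    have := mem_homKer.1 hx ((j.comp ψ).comp (S.comap ψ).subtype)
    exact hj (this.trans (map_one j).symm)
  have : V.FiniteIndex := by
    constructor
    have h1 := (homKer_finiteIndex (H := H) b).index_ne_zero
    rw [Subgroup.index_map_subtype]
    refine mul_ne_zero h1 ?_
    rw [Subgroup.index_comap_of_surjective _ hψ]
    exact Subgroup.index_ne_zero_of_finite
  let π : F ⧸ V →* R := QuotientGroup.lift V ψ hVψ
  let q : S.comap ψ →* S.comap π :=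
    ((QuotientGroup.mk' V).comp (S.comap ψ).subtype).codRestrict _ fun x => x.2
  refine ⟨F ⧸ V, inferInstance, inferInstance, π, q, ?_, ?_, fun x => rfl, fun x => ?_⟩
  · intro r
    obtain ⟨x, rfl⟩ := hψ r
    exact ⟨x, rfl⟩
  · rintro ⟨y, hy⟩
    obtain ⟨x, rfl⟩ := QuotientGroup.mk_surjective y
    exact ⟨⟨x, hy⟩, rfl⟩
  · rw [Subtype.ext_iff]
    change ((x : F) : F ⧸ V) = 1 ↔ _
    rw [QuotientGroup.eq_one_iff]
    exact Subgroup.mem_map_iff_mem (Subgroup.subtype_injective _)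

/-- Finite covers of two finite groups in which the preimages of normal subgroups of equal index,
and of subgroups of prime index therein, become isomorphic. -/
theorem exists_free_cover {R₁ R₂ : Type} [Group R₁] [Group R₂] [Finite R₁] [Finite R₂]
    {S₁ T₁ : Subgroup R₁} {S₂ T₂ : Subgroup R₂} [S₁.Normal] [S₂.Normal] [T₁.Normal] [T₂.Normal]
    (hT₁ : T₁ ≤ S₁) (hT₂ : T₂ ≤ S₂) {p : ℕ} (hp : p.Prime) (h₁ : T₁.relIndex S₁ = p)
    (h₂ : T₂.relIndex S₂ = p) (hS : S₁.index = S₂.index) :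
    ∃ (R₁' R₂' : Type) (_ : Group R₁') (_ : Group R₂') (_ : Finite R₁') (_ : Finite R₂')
      (π₁ : R₁' →* R₁) (π₂ : R₂' →* R₂), Function.Surjective π₁ ∧ Function.Surjective π₂ ∧
      Nonempty (S₁.comap π₁ ≃* S₂.comap π₂) ∧ Nonempty (T₁.comap π₁ ≃* T₂.comap π₂) := by
  let ψ₁ : FreeGroup (R₁ × R₂) →* R₁ := FreeGroup.lift Prod.fst
  let ψ₂ : FreeGroup (R₁ × R₂) →* R₂ := FreeGroup.lift Prod.snd
  have hψ₁ : Function.Surjective ψ₁ := fun r => ⟨FreeGroup.of (r, 1), by simp [ψ₁]⟩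
  have hψ₂ : Function.Surjective ψ₂ := fun r => ⟨FreeGroup.of (1, r), by simp [ψ₂]⟩
  have i₁ := Subgroup.index_comap_of_surjective S₁ hψ₁
  have i₂ := Subgroup.index_comap_of_surjective S₂ hψ₂
  have : (S₁.comap ψ₁).FiniteIndex := ⟨by rw [i₁]; exact Subgroup.index_ne_zero_of_finite⟩
  have : (S₂.comap ψ₂).FiniteIndex := ⟨by rw [i₂]; exact Subgroup.index_ne_zero_of_finite⟩
  obtain ⟨n, ⟨b₁⟩, hn⟩ := exists_basis_of_finiteIndex (S₁.comap ψ₁)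
  obtain ⟨n', ⟨b₂⟩, hn'⟩ := exists_basis_of_finiteIndex (S₂.comap ψ₂)
  obtain rfl : n' = n := by rw [i₁] at hn; rw [i₂, ← hS] at hn'; omega
  have r₁ : ((T₁.comap ψ₁).subgroupOf (S₁.comap ψ₁)).index = p := by
    rw [← h₁]
    change (T₁.comap ψ₁).relIndex _ = _
    rw [Subgroup.relIndex_comap, Subgroup.map_comap_eq_self_of_surjective hψ₁]
  have r₂ : ((T₂.comap ψ₂).subgroupOf (S₂.comap ψ₂)).index = p := by
    rw [← h₂]
    change (T₂.comap ψ₂).relIndex _ = _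
    rw [Subgroup.relIndex_comap, Subgroup.map_comap_eq_self_of_surjective hψ₂]
  obtain ⟨e, he⟩ := exists_equiv_forall_mem_iff b₁ b₂ hp _ _ r₁ r₂
  -- The common target `R₁ × R₂` contains both groups, so any isomorphism `e` matches the two
  -- subgroups `homKer`.
  obtain ⟨R₁', _, _, π₁, q₁, hπ₁, hq₁, hπq₁, hk₁⟩ := exists_cover_of_free (H := R₁ × R₂) ψ₁ hψ₁
    (MonoidHom.inl R₁ R₂) (Prod.mk_left_injective 1) S₁ b₁
  obtain ⟨R₂', _, _, π₂, q₂, hπ₂, hq₂, hπq₂, hk₂⟩ := exists_cover_of_free (H := R₁ × R₂) ψ₂ hψ₂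
    (MonoidHom.inr R₁ R₂) (Prod.mk_right_injective 1) S₂ b₂
  obtain ⟨e', he'⟩ := exists_equiv_of_surjective q₁ q₂ hq₁ hq₂ e fun x => by
    rw [hk₁, hk₂, mem_homKer_equiv]
  refine ⟨R₁', R₂', _, _, inferInstance, inferInstance, π₁, π₂, hπ₁, hπ₂, ⟨e'⟩,
    nonempty_equiv_of_mem_iff (Subgroup.comap_mono hT₁) (Subgroup.comap_mono hT₂) e' fun y => ?_⟩
  obtain ⟨x, rfl⟩ := hq₁ y
  rw [he', Subgroup.mem_comap, Subgroup.mem_comap, hπq₁, hπq₂]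
  exact he x

/-! ### Central elements of prime order -/

/-- Every prime divisor of the order of a finite nilpotent group divides the order of its center. -/
theorem prime_dvd_card_center {p : ℕ} (hp : p.Prime) (G : Type*) [Group G] [Group.IsNilpotent G] :
    Finite G → p ∣ Nat.card G → p ∣ Nat.card (Subgroup.center G) := by
  have : Fact p.Prime := ⟨hp⟩
  refine Group.nilpotent_center_quotient_ind (P := fun G _ _ =>
    Finite G → p ∣ Nat.card G → p ∣ Nat.card (Subgroup.center G)) G ?_ ?_
  · intro G _ _ _ h
    rw [Nat.card_of_subsingleton (1 : G)] at h
    exact absurd (Nat.dvd_one.1 h) hp.one_lt.ne'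
  · intro G _ _ ih _ h
    -- Lift a central element of order `p` of the quotient by the center to `x`. With `m` the order
    -- of the center, `x ^ m` is noncentral of exponent `p`, but its commutators are central of
    -- exponent `p`, hence trivial as `p ∤ m`.
    by_contra hZ
    rw [Subgroup.card_eq_card_quotient_mul_card_subgroup (Subgroup.center G), hp.dvd_mul] at h
    obtain ⟨⟨c, hcZ⟩, hc⟩ := exists_prime_orderOf_dvd_card' p (ih inferInstance (h.resolve_right hZ))
    rw [Subgroup.orderOf_mk] at hc
    obtain ⟨x, rfl⟩ := QuotientGroup.mk_surjective c
    set m := Nat.card (Subgroup.center G) with hm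
    have hxp : x ^ p ∈ Subgroup.center G := by
      rw [← QuotientGroup.eq_one_iff, QuotientGroup.mk_pow, ← hc, pow_orderOf_eq_one]
    have hy : (x ^ m) ^ p = 1 := by
      rw [← pow_mul, mul_comm, pow_mul]
      have : (⟨x ^ p, hxp⟩ : Subgroup.center G) ^ m = 1 := pow_card_eq_one'
      exact congrArg Subtype.val this
    have hyZ : x ^ m ∉ Subgroup.center G := by
      rw [← QuotientGroup.eq_one_iff, QuotientGroup.mk_pow, ← orderOf_dvd_iff_pow_eq_one, hc]
      exact hZ
    refine hyZ (Subgroup.mem_center_iff.2 fun g => ?_)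
    have hz : (x ^ m)⁻¹ * (g * x ^ m * g⁻¹) ∈ Subgroup.center G := by
      rw [← QuotientGroup.eq_one_iff, QuotientGroup.mk_mul, QuotientGroup.mk_mul,
        QuotientGroup.mk_mul, QuotientGroup.mk_inv, QuotientGroup.mk_inv, QuotientGroup.mk_pow]
      rw [Subgroup.mem_center_iff.1 (Subgroup.pow_mem _ hcZ m) (g : G ⧸ Subgroup.center G)]
      simp
    set z := (x ^ m)⁻¹ * (g * x ^ m * g⁻¹) with hzdef
    have hgz : g * x ^ m * g⁻¹ = x ^ m * z := by rw [hzdef, mul_inv_cancel_left]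
    have hzp : z ^ p = 1 := by
      have h1 : (g * x ^ m * g⁻¹) ^ p = 1 := by rw [conj_pow, hy]; simp
      have hcomm : Commute (x ^ m) z := Subgroup.mem_center_iff.1 hz _
      rwa [hgz, hcomm.mul_pow, hy, one_mul] at h1
    have hz1 : z = 1 := by
      by_contra hne
      apply hZ
      have h1 : orderOf (⟨z, hz⟩ : Subgroup.center G) = p := by
        rw [Subgroup.orderOf_mk]; exact orderOf_eq_prime hzp hne
      rw [hm, ← h1]
      exact orderOf_dvd_natCard _
    rw [hz1, mul_one] at hgz
    exact mul_inv_eq_iff_eq_mul.1 hgz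

theorem exists_normal_relIndex_eq {R : Type*} [Group R] [Finite R] (T : Subgroup R) [T.Normal]
    [Group.IsNilpotent (R ⧸ T)] {p : ℕ} (hp : p.Prime) (h : p ∣ T.index) :
    ∃ S : Subgroup R, S.Normal ∧ T ≤ S ∧ T.relIndex S = p ∧
      ∀ [S.Normal], Group.IsNilpotent (R ⧸ S) := by
  have : Fact p.Prime := ⟨hp⟩
  obtain ⟨⟨z, hz⟩, ho⟩ := exists_prime_orderOf_dvd_card' p
    (prime_dvd_card_center hp (R ⧸ T) inferInstance h)
  rw [Subgroup.orderOf_mk] at ho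
  have hN : (Subgroup.zpowers z).Normal := ⟨fun y hy g => by
    have : y ∈ Subgroup.center (R ⧸ T) := Subgroup.zpowers_le.2 hz hy
    rwa [Subgroup.mem_center_iff.1 this g, mul_inv_cancel_right]⟩
  have hle : T ≤ (Subgroup.zpowers z).comap (QuotientGroup.mk' T) := fun x hx => by
    rw [Subgroup.mem_comap, QuotientGroup.mk'_apply, (QuotientGroup.eq_one_iff x).2 hx]
    exact Subgroup.one_mem _
  refine ⟨(Subgroup.zpowers z).comap (QuotientGroup.mk' T), inferInstance, hle, ?_, ?_⟩
  · have h1 := Subgroup.relIndex_comap ⊥ (QuotientGroup.mk' T)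
      ((Subgroup.zpowers z).comap (QuotientGroup.mk' T))
    rwa [Subgroup.map_comap_eq_self_of_surjective (QuotientGroup.mk'_surjective T),
      MonoidHom.comap_bot, QuotientGroup.ker_mk', Subgroup.relIndex_bot_left, Nat.card_zpowers,
      ho] at h1
  · intro _
    refine Group.nilpotent_of_surjective (QuotientGroup.map T _ (MonoidHom.id R) hle) fun y => ?_
    obtain ⟨x, rfl⟩ := QuotientGroup.mk_surjective y
    exact ⟨x, rfl⟩

theorem isNilpotent_quotient_comap {R R' : Type*} [Group R] [Group R'] (π : R' →* R)
    (hπ : Function.Surjective π) (S : Subgroup R) [S.Normal] [Group.IsNilpotent (R ⧸ S)] :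
    Group.IsNilpotent (R' ⧸ S.comap π) := by
  have hk : ((QuotientGroup.mk' S).comp π).ker = S.comap π := by
    rw [← MonoidHom.comap_ker, QuotientGroup.ker_mk']
  have e := (QuotientGroup.quotientMulEquivOfEq hk).symm.trans
    (QuotientGroup.quotientKerEquivOfSurjective _ ((QuotientGroup.mk'_surjective S).comp hπ))
  exact Group.nilpotent_of_mulEquiv e.symm

/-! ### Induction on the index -/

/-- Normal subgroups of equal index with nilpotent quotients have isomorphic preimages in some
finite group mapping onto both quotients. -/
theorem exists_common_of_isNilpotent_quotient (n : ℕ) :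
    ∀ (R₁ R₂ : Type) [Group R₁] [Group R₂] [Finite R₁] [Finite R₂] (T₁ : Subgroup R₁)
      (T₂ : Subgroup R₂) [T₁.Normal] [T₂.Normal] [Group.IsNilpotent (R₁ ⧸ T₁)]
      [Group.IsNilpotent (R₂ ⧸ T₂)], T₁.index = n → T₂.index = n →
    ∃ (P : Type) (_ : Group P) (_ : Finite P) (f₁ : P →* R₁) (f₂ : P →* R₂),
      T₁ ⊔ f₁.range = ⊤ ∧ T₂ ⊔ f₂.range = ⊤ ∧ Nonempty (T₁.comap f₁ ≃* T₂.comap f₂) := by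
  induction n using Nat.strong_induction_on with
  | _ n ih =>
  intro R₁ R₂ _ _ _ _ T₁ T₂ _ _ _ _ h₁ h₂
  by_cases hn : n = 1
  · rw [hn, Subgroup.index_eq_one] at h₁ h₂
    subst h₁ h₂
    -- The trivial group suffices, as surjectivity is required only modulo `Tᵢ`.
    exact ⟨Unit, inferInstance, inferInstance, 1, 1, top_sup_eq _, top_sup_eq _,
      ⟨MulEquiv.refl _⟩⟩
  have hp := Nat.minFac_prime hn
  set p := n.minFac with hpdef
  obtain ⟨S₁, _, hT₁, hr₁, hS₁⟩ := exists_normal_relIndex_eq T₁ hp (h₁ ▸ n.minFac_dvd)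
  obtain ⟨S₂, _, hT₂, hr₂, hS₂⟩ := exists_normal_relIndex_eq T₂ hp (h₂ ▸ n.minFac_dvd)
  have i₁ := Subgroup.relIndex_mul_index hT₁
  have i₂ := Subgroup.relIndex_mul_index hT₂
  rw [hr₁, h₁] at i₁
  rw [hr₂, h₂] at i₂
  have hi : S₁.index = S₂.index := Nat.eq_of_mul_eq_mul_left hp.pos (i₁.trans i₂.symm)
  have hlt : S₁.index < n := by
    have : 0 < S₁.index := Nat.pos_of_ne_zero Subgroup.index_ne_zero_of_finite
    have := hp.one_lt
    nlinarith
  obtain ⟨R₁', R₂', _, _, _, _, π₁, π₂, hπ₁, hπ₂, ⟨eS⟩, ⟨eT⟩⟩ :=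
    exists_free_cover hT₁ hT₂ hp hr₁ hr₂ hi
  have := hS₁
  have := hS₂
  have := isNilpotent_quotient_comap π₁ hπ₁ S₁
  have := isNilpotent_quotient_comap π₂ hπ₂ S₂
  obtain ⟨P, _, _, f₁, f₂, hf₁, hf₂, ⟨φ⟩⟩ := ih _ hlt R₁' R₂' (S₁.comap π₁) (S₂.comap π₂)
    (Subgroup.index_comap_of_surjective _ hπ₁)
    ((Subgroup.index_comap_of_surjective _ hπ₂).trans hi.symm)
  obtain ⟨G, _, _, g₁, g₂, hg₁, hg₂, e⟩ := exists_cover_of_equiv f₁ f₂ _ _ _ _ hf₁ hf₂ φ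
    (Subgroup.comap_mono hT₁) (Subgroup.comap_mono hT₂) eS eT
  refine ⟨G, _, inferInstance, π₁.comp g₁, π₂.comp g₂, ?_, ?_, e⟩
  · rw [MonoidHom.range_eq_top.2 (by rw [MonoidHom.coe_comp]; exact hπ₁.comp hg₁), sup_top_eq]
  · rw [MonoidHom.range_eq_top.2 (by rw [MonoidHom.coe_comp]; exact hπ₂.comp hg₂), sup_top_eq]

theorem groupsCompatible_of_isNilpotent_quotient {L₁ L₂ : Type} [Group L₁] [Group L₂] [Finite L₁]
    [Finite L₂] (hcard : Nat.card L₁ = Nat.card L₂) (N₁ : Subgroup L₁) (N₂ : Subgroup L₂)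
    [N₁.Normal] [N₂.Normal] (e : N₁ ≃* N₂) [Group.IsNilpotent (L₁ ⧸ N₁)]
    [Group.IsNilpotent (L₂ ⧸ N₂)] : GroupsCompatible L₁ L₂ := by
  have hi : N₂.index = N₁.index := by
    have h₁ := N₁.card_mul_index
    have h₂ := N₂.card_mul_index
    rw [← Nat.card_congr e.toEquiv, ← hcard, ← h₁] at h₂
    exact Nat.eq_of_mul_eq_mul_left Nat.card_pos h₂
  obtain ⟨P, _, _, f₁, f₂, hf₁, hf₂, ⟨φ⟩⟩ :=
    exists_common_of_isNilpotent_quotient _ L₁ L₂ N₁ N₂ rfl hi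
  obtain ⟨G, _, _, g₁, g₂, hg₁, hg₂, e'⟩ := exists_cover_of_equiv f₁ f₂ N₁ ⊥ N₂ ⊥ hf₁ hf₂ φ
    bot_le bot_le e MulEquiv.ofUnique
  exact ⟨G, _, inferInstance, g₁.ker, g₂.ker, inferInstance, inferInstance, e',
    ⟨(QuotientGroup.quotientKerEquivOfSurjective g₁ hg₁).symm⟩,
    ⟨(QuotientGroup.quotientKerEquivOfSurjective g₂ hg₂).symm⟩⟩

theorem GroupsCompatible.congr {L₁ L₂ L₁' L₂' : Type*} [Group L₁] [Group L₂] [Group L₁']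
    [Group L₂'] (e₁ : L₁ ≃* L₁') (e₂ : L₂ ≃* L₂') (h : GroupsCompatible L₁' L₂') :
    GroupsCompatible L₁ L₂ := by
  obtain ⟨G, _, hG, M₁, M₂, hM₁, hM₂, e, ⟨a₁⟩, ⟨a₂⟩⟩ := h
  exact ⟨G, _, hG, M₁, M₂, hM₁, hM₂, e, ⟨e₁.trans a₁⟩, ⟨e₂.trans a₂⟩⟩

theorem mainTheorem3 {L₁ : Type*} {L₂ : Type*} [Group L₁] [Group L₂] [Finite L₁] [Finite L₂]
    (hcard : Nat.card L₁ = Nat.card L₂) :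
    (∀ (N₁ : Subgroup L₁) (N₂ : Subgroup L₂) [N₁.Normal] [N₂.Normal],
      Nonempty (N₁ ≃* N₂) → Group.IsNilpotent (L₁ ⧸ N₁) → Group.IsNilpotent (L₂ ⧸ N₂) →
        GroupsCompatible L₁ L₂) ∧
    (Group.IsNilpotent L₁ → Group.IsNilpotent L₂ → GroupsCompatible L₁ L₂) := by
  have main : ∀ (N₁ : Subgroup L₁) (N₂ : Subgroup L₂) [N₁.Normal] [N₂.Normal],
      Nonempty (N₁ ≃* N₂) → Group.IsNilpotent (L₁ ⧸ N₁) → Group.IsNilpotent (L₂ ⧸ N₂) →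
        GroupsCompatible L₁ L₂ := by
    intro N₁ N₂ _ _ ⟨e⟩ _ _
    -- The induction takes place in `Type`, so finite groups from other universes are first replaced
    -- by small copies.
    let s₁ : Shrink.{0} L₁ ≃* L₁ := Shrink.mulEquiv
    let s₂ : Shrink.{0} L₂ ≃* L₂ := Shrink.mulEquiv
    have := isNilpotent_quotient_comap s₁.toMonoidHom s₁.surjective N₁
    have := isNilpotent_quotient_comap s₂.toMonoidHom s₂.surjective N₂
    have : Finite (Shrink.{0} L₁) := Finite.of_equiv _ s₁.symm.toEquiv
    have : Finite (Shrink.{0} L₂) := Finite.of_equiv _ s₂.symm.toEquiv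
    refine GroupsCompatible.congr s₁.symm s₂.symm (groupsCompatible_of_isNilpotent_quotient
      ?_ (N₁.comap s₁.toMonoidHom) (N₂.comap s₂.toMonoidHom) ?_)
    · rw [Nat.card_congr s₁.toEquiv, Nat.card_congr s₂.toEquiv, hcard]
    · exact (((s₁.subgroupMap _).trans (MulEquiv.subgroupCongr
        (Subgroup.map_comap_eq_self_of_surjective s₁.surjective N₁))).trans e).trans
        ((s₂.subgroupMap _).trans (MulEquiv.subgroupCongr
        (Subgroup.map_comap_eq_self_of_surjective s₂.surjective N₂))).symm
  exact ⟨main, fun _ _ => main ⊥ ⊥ ⟨MulEquiv.ofUnique⟩ inferInstance inferInstance⟩
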